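/- Let $\mathcal S$ be the topos of trees: its objects $X$ are sequences of sets $X_1,X_2,\dots$ with restriction functions $r_i^X:X_{i+1}\to X_i$, and its arrows are families of functions $X_i\to Y_i$ commuting with the restriction functions. For a set $Z$ let $\Delta Z$ be the constant object $Z\xleftarrow{\mathrm{id}}Z\xleftarrow{\mathrm{id}}\cdots$; let $\blacktriangleright X$ be the object $\{\ast\}\leftarrow X_1\leftarrow X_2\leftarrow\cdots$, and let $\blacksquare X=\Delta(\mathrm{hom}_{\mathcal S}(1,X))$. The $\mathsf g\lambda$-types are generated by $$A ::= \alpha \mid \mathbf N \mid \mathbf 1 \mid A\times A \mid \mathbf 0 \mid A+A \mid A\to A \mid \mu\alpha.A \mid \blacktriangleright A \mid \blacksquare A,$$ where $\mu\alpha.A$ may be formed only if every occurrence of $\alpha$ in $A$ is beneath a $\blacktriangleright$, and $\blacksquare A$ only if $A$ is closed. A type $A$ with $n$ free variables denotes a functor $[\![A]\!]:(\mathcal S^{op}\times\mathcal S)^n\to\mathcal S$. A variable denotes the projection to its positive component; $\mathbf N,\mathbf 1,\mathbf 0$ denote the constant functors at $\Delta\mathbb N,\Delta\{\ast\},\Delta\emptyset$;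 $\times$ and $+$ denote the pointwise product and coproduct; $[\![A\to B]\!](W)=[\![B]\!](W)^{[\![A]\!](W')}$ is the exponential in $\mathcal S$, where $W'$ is $W$ with the two components of each pair exchanged; $\blacktriangleright$ and $\blacksquare$ denote composition with the functors above; and $[\![\mu\alpha.A]\!]$ is the fixed point of $[\![A]\!]$ in the arguments for $\alpha$, i.e. the functor $G$, unique up to isomorphism, such that $[\![A]\!](W,G(W'),G(W))\cong G(W)$ naturally in $W$ (for $n=0$, the object $X$ with $[\![A]\!](X,X)\cong X$). A closed type thus denotes an object of $\mathcal S$. **Corollary.** Every closed $\mathsf g\lambda$-type $A$ that does not have the empty type $\mathbf 0$ in its syntax tree is total and inhabited: all the sets $[\![A]\!]_i$ are non-empty and all the restriction functions $[\![A]\!]_{i+1}\to[\![A]\!]_i$ are surjective. -/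

import Mathlib

open CategoryTheory Opposite

/-! ### The topos of trees -/

/-- An object of the topos of trees: a sequence of sets with restriction functions.  Stages are
indexed from `0`, so that `X.set i` is the set usually written `X_{i+1}`. -/
structure TreeObj where
  set : ℕ → Type
  res : ∀ i, set (i + 1) → set i

namespace TreeObj

/-- Arrows are families of functions that commute with the restriction functions. -/
@[ext]
structure Hom (X Y : TreeObj) where
  app : ∀ i, X.set i → Y.set i
  naturality : ∀ i (x : X.set (i + 1)), app i (X.res i x) = Y.res i (app (i + 1) x)

instance : Category TreeObj where
  Hom := Hom
  id X := ⟨fun _ x => x, fun _ _ => rfl⟩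
  comp f g := ⟨fun i x => g.app i (f.app i x), fun i x => by
    rw [f.naturality, g.naturality]⟩

theorem hom_ext {X Y : TreeObj} {f g : X ⟶ Y} (h : ∀ i x, f.app i x = g.app i x) : f = g :=
  Hom.ext (funext fun i => funext fun x => h i x)

@[simp]
theorem id_app (X : TreeObj) (i : ℕ) (x : X.set i) : Hom.app (𝟙 X) i x = x := rfl

@[simp]
theorem comp_app {X Y Z : TreeObj} (f : X ⟶ Y) (g : Y ⟶ Z) (i : ℕ) (x : X.set i) :
    Hom.app (f ≫ g) i x = g.app i (f.app i x) := rfl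

/-- All restriction functions are surjective, and all sets are non-empty. -/
structure TotalInhabited (X : TreeObj) : Prop where
  total : ∀ i, Function.Surjective (X.res i)
  inhabited : ∀ i, Nonempty (X.set i)

/-- The constant object `Δ Z`. -/
def const (Z : Type) : TreeObj := ⟨fun _ => Z, fun _ z => z⟩

/-- Binary products, computed pointwise. -/
def prod (X Y : TreeObj) : TreeObj :=
  ⟨fun i => X.set i × Y.set i, fun i p => (X.res i p.1, Y.res i p.2)⟩

/-- Action of binary products on arrows. -/
def prodMap {X X' Y Y' : TreeObj} (f : X ⟶ X') (g : Y ⟶ Y') : X.prod Y ⟶ X'.prod Y' :=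
  ⟨fun i p => (f.app i p.1, g.app i p.2), fun i p =>
    Prod.ext (f.naturality i p.1) (g.naturality i p.2)⟩

/-- Binary coproducts, computed pointwise. -/
def sum (X Y : TreeObj) : TreeObj :=
  ⟨fun i => X.set i ⊕ Y.set i, fun i => Sum.map (X.res i) (Y.res i)⟩

/-- Action of binary coproducts on arrows. -/
def sumMap {X X' Y Y' : TreeObj} (f : X ⟶ X') (g : Y ⟶ Y') : X.sum Y ⟶ X'.sum Y' :=
  ⟨fun i => Sum.map (f.app i) (g.app i), fun i p => by
    cases p with
    | inl x => exact congrArg Sum.inl (f.naturality i x)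
    | inr y => exact congrArg Sum.inr (g.naturality i y)⟩

/-- Elements of the exponential `Y ^ X` at stage `i`: tuples of functions `X_k → Y_k` for all
stages `k ≤ i`, commuting with the restriction functions. -/
@[ext]
structure ExpSet (X Y : TreeObj) (i : ℕ) where
  fn : ∀ k, k ≤ i → X.set k → Y.set k
  naturality : ∀ k (h : k + 1 ≤ i) (x : X.set (k + 1)),
    fn k (Nat.le_of_succ_le h) (X.res k x) = Y.res k (fn (k + 1) h x)

/-- The exponential `Y ^ X`; the restriction functions forget the last function of a tuple. -/
def exp (X Y : TreeObj) : TreeObj :=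
  ⟨ExpSet X Y, fun _ t =>
    ⟨fun k h => t.fn k (Nat.le_succ_of_le h), fun k h => t.naturality k (Nat.le_succ_of_le h)⟩⟩

/-- Action of exponentials on arrows, by pre- and postcomposition. -/
def expMap {X X' Y Y' : TreeObj} (f : X' ⟶ X) (g : Y ⟶ Y') : X.exp Y ⟶ X'.exp Y' :=
  ⟨fun _ t =>
    ⟨fun k h x => g.app k (t.fn k h (f.app k x)), fun k h x => by
      rw [f.naturality, t.naturality, g.naturality]⟩,
    fun _ _ => rfl⟩

/-- The sets of `▷ X`: a singleton, followed by the sets of `X`. -/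
def laterSet (X : TreeObj) : ℕ → Type
  | 0 => PUnit
  | i + 1 => X.set i

/-- The restriction functions of `▷ X`. -/
def laterRes (X : TreeObj) : ∀ i, laterSet X (i + 1) → laterSet X i
  | 0 => fun _ => PUnit.unit
  | i + 1 => X.res i

/-- The components of `▷ f`. -/
def laterApp {X Y : TreeObj} (f : X ⟶ Y) : ∀ i, laterSet X i → laterSet Y i
  | 0 => fun x => x
  | i + 1 => f.app i

/-- The functor `▷`. -/
def later : TreeObj ⥤ TreeObj where
  obj X := ⟨laterSet X, laterRes X⟩
  map {X Y} f := ⟨laterApp f, fun i x => by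
    cases i with
    | zero => rfl
    | succ i => exact f.naturality i x⟩
  map_id X := hom_ext fun i _ => by cases i <;> rfl
  map_comp f g := hom_ext fun i _ => by cases i <;> rfl

/-- The functor `■`, sending `X` to the constant object on the set of global elements
`1 ⟶ X`. -/
def box : TreeObj ⥤ TreeObj where
  obj X := const (const PUnit ⟶ X)
  map f := ⟨fun _ x => x ≫ f, fun _ _ => rfl⟩

end TreeObj

/-! ### Functors of mixed variance -/

/-- The category `(𝓢ᵒᵖ × 𝓢)ⁿ`, where `𝓢` is the topos of trees. -/
abbrev Env (n : ℕ) : Type 1 := Fin n → TreeObjᵒᵖ × TreeObj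

namespace Env

variable {n : ℕ}

/-- The functor `W ↦ W'` exchanging the two polarities. -/
def swap : (Env n)ᵒᵖ ⥤ Env n where
  obj W := fun i => (op (W.unop i).2, (W.unop i).1.unop)
  map f := fun i => ((f.unop i).2.op, (f.unop i).1.unop)

/-- For `G : (𝓢ᵒᵖ × 𝓢)ⁿ ⥤ 𝓢`, the functor `W ↦ (W, G W', G W)` to `(𝓢ᵒᵖ × 𝓢)ⁿ⁺¹`.
The new pair has index `0`. -/
def extend (G : Env n ⥤ TreeObj) : Env n ⥤ Env (n + 1) where
  obj W := Fin.cases (op (G.obj (swap.obj (op W))), G.obj W) W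
  map {_ _} f := Fin.cases ((G.map (swap.map f.op)).op, G.map f) f
  map_id W := by
    funext i
    refine Fin.cases ?_ (fun j => rfl) i
    refine Prod.ext ?_ (G.map_id W)
    exact congrArg Quiver.Hom.op (G.map_id (swap.obj (op W)))
  map_comp f g := by
    funext i
    refine Fin.cases ?_ (fun j => rfl) i
    refine Prod.ext ?_ (G.map_comp f g)
    exact congrArg Quiver.Hom.op (G.map_comp (swap.map g.op) (swap.map f.op))

/-- The constant functor at a constant object. -/
def constF (Z : Type) : Env n ⥤ TreeObj := (Functor.const _).obj (TreeObj.const Z)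

/-- Projection to the positive component of variable `i`. -/
def varF (i : Fin n) : Env n ⥤ TreeObj where
  obj W := (W i).2
  map f := (f i).2

/-- Pointwise products of functors. -/
def prodF (F G : Env n ⥤ TreeObj) : Env n ⥤ TreeObj where
  obj W := (F.obj W).prod (G.obj W)
  map f := TreeObj.prodMap (F.map f) (G.map f)
  map_id W := by
    rw [F.map_id, G.map_id]; rfl
  map_comp f g := by
    rw [F.map_comp, G.map_comp]; rfl

/-- Pointwise sums of functors. -/
def sumF (F G : Env n ⥤ TreeObj) : Env n ⥤ TreeObj where
  obj W := (F.obj W).sum (G.obj W)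
  map f := TreeObj.sumMap (F.map f) (G.map f)
  map_id W := by
    rw [F.map_id, G.map_id]
    exact TreeObj.hom_ext fun i x => by cases x <;> rfl
  map_comp f g := by
    rw [F.map_comp, G.map_comp]
    exact TreeObj.hom_ext fun i x => by cases x <;> rfl

/-- The functor `W ↦ G(W) ^ F(W')`. -/
def expF (F G : Env n ⥤ TreeObj) : Env n ⥤ TreeObj where
  obj W := (F.obj (swap.obj (op W))).exp (G.obj W)
  map f := TreeObj.expMap (F.map (swap.map f.op)) (G.map f)
  map_id W := by
    rw [op_id, swap.map_id, F.map_id, G.map_id]; rfl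
  map_comp f g := by
    rw [op_comp, swap.map_comp, F.map_comp, G.map_comp]; rfl

open Classical in
/-- The fixed point of `F : (𝓢ᵒᵖ × 𝓢)ⁿ⁺¹ ⥤ 𝓢` in its last pair of arguments: a functor
`G : (𝓢ᵒᵖ × 𝓢)ⁿ ⥤ 𝓢` with `F (W, G W', G W) ≅ G W`, naturally in `W`; for `n = 0` this is an
object `X` with `F (X, X) ≅ X`. It exists and is unique up to isomorphism when `F` is locally
contractive in that pair. If there is none, the value is the constant functor at the initial
object, which is not inhabited. -/
noncomputable def fix (F : Env (n + 1) ⥤ TreeObj) : Env n ⥤ TreeObj :=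
  if h : ∃ G : Env n ⥤ TreeObj, Nonempty (extend G ⋙ F ≅ G) then h.choose else constF Empty

end Env

/-! ### Types of the guarded lambda-calculus -/

/-- Type expressions with free variables among `n` variables, in de Bruijn notation: `mu` binds
the variable `0`. The constant modality `box` applies only to closed types. -/
inductive Ty : ℕ → Type
  | var {n : ℕ} (i : Fin n) : Ty n
  | nat {n : ℕ} : Ty n
  | one {n : ℕ} : Ty n
  | prod {n : ℕ} (A B : Ty n) : Ty n
  | zero {n : ℕ} : Ty n
  | sum {n : ℕ} (A B : Ty n) : Ty n
  | arrow {n : ℕ} (A B : Ty n) : Ty n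
  | mu {n : ℕ} (A : Ty (n + 1)) : Ty n
  | later {n : ℕ} (A : Ty n) : Ty n
  | box {n : ℕ} (A : Ty 0) : Ty n

namespace Ty

/-- `A.Guarded i`: all occurrences of the variable `i` in `A` are beneath an occurrence of
`later`. -/
def Guarded : {n : ℕ} → Ty n → Fin n → Prop
  | _, var j, i => j ≠ i
  | _, nat, _ => True
  | _, one, _ => True
  | _, prod A B, i => A.Guarded i ∧ B.Guarded i
  | _, zero, _ => True
  | _, sum A B, i => A.Guarded i ∧ B.Guarded i
  | _, arrow A B, i => A.Guarded i ∧ B.Guarded i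
  | _, mu A, i => A.Guarded i.succ
  | _, later _, _ => True
  | _, box _, _ => True

/-- The type formation judgment: every `mu` binds a variable that is guarded in its body. (The
conditions on variables and on `box` are part of the syntax `Ty n`.) -/
def WellFormed : {n : ℕ} → Ty n → Prop
  | _, var _ => True
  | _, nat => True
  | _, one => True
  | _, prod A B => A.WellFormed ∧ B.WellFormed
  | _, zero => True
  | _, sum A B => A.WellFormed ∧ B.WellFormed
  | _, arrow A B => A.WellFormed ∧ B.WellFormed
  | _, mu A => A.Guarded 0 ∧ A.WellFormed
  | _, later A => A.WellFormed
  | _, box A => A.WellFormed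

/-- The empty type occurs in the syntax tree. -/
def HasZero : {n : ℕ} → Ty n → Prop
  | _, var _ => False
  | _, nat => False
  | _, one => False
  | _, prod A B => A.HasZero ∨ B.HasZero
  | _, zero => True
  | _, sum A B => A.HasZero ∨ B.HasZero
  | _, arrow A B => A.HasZero ∨ B.HasZero
  | _, mu A => A.HasZero
  | _, later A => A.HasZero
  | _, box A => A.HasZero

/-- The functor denoted by a type with `n` free variables. -/
noncomputable def denF : {n : ℕ} → Ty n → (Env n ⥤ TreeObj)
  | _, var i => Env.varF i
  | _, nat => Env.constF ℕ
  | _, one => Env.constF PUnit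
  | _, prod A B => Env.prodF A.denF B.denF
  | _, zero => Env.constF Empty
  | _, sum A B => Env.sumF A.denF B.denF
  | _, arrow A B => Env.expF A.denF B.denF
  | _, mu A => Env.fix A.denF
  | _, later A => A.denF ⋙ TreeObj.later
  | _, box A => (Functor.const _).obj (TreeObj.box.obj (A.denF.obj Fin.elim0))

/-- The object of the topos of trees denoted by a closed type. -/
noncomputable def den (A : Ty 0) : TreeObj := A.denF.obj Fin.elim0

end Ty

/-! The theorem is an induction on types carrying a stage bound: the denotation is total and
inhabited up to stage `k` once the positive arguments are so below `k`, and at `k` too for unguarded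
variables. `▷` shifts by one stage, so a guarded fixed point inherits each stage from the earlier
ones. Negative arguments play no role: an exponential is total and inhabited as soon as its codomain
is. Under `■`, totality together with a point at the first stage yields a global element
(`totalInhabitedBelow_denF`).

This uses nothing of `fix` but an isomorphism `F (W, G W', G W) ≅ G W`, whose existence is the
harder half. Contractivity is expressed through `LocalOn`, by the stages at which arrows are
bijective. Mixed variance calls for two interleaved towers of approximations, one from the initial
and one from the terminal functor; stage by stage they become isomorphic, and the limit of the upper
one is a fixed point (`exists_extend_iso`). -/

namespace TreeObj

/-! ### Bijectivity and surjectivity on initial segments of stages -/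

/-- The components of `f` at stages below `k` are bijective. -/
def BijBelow (k : ℕ) {X Y : TreeObj} (f : X ⟶ Y) : Prop :=
  ∀ i, i < k → Function.Bijective (f.app i)

theorem BijBelow.mono {k l : ℕ} (h : k ≤ l) {X Y : TreeObj} {f : X ⟶ Y} (hf : BijBelow l f) :
    BijBelow k f := fun i hi => hf i (hi.trans_le h)

theorem bijBelow_zero {X Y : TreeObj} (f : X ⟶ Y) : BijBelow 0 f :=
  fun _ hi => absurd hi (Nat.not_lt_zero _)

theorem bijBelow_id (k : ℕ) (X : TreeObj) : BijBelow k (𝟙 X) :=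
  fun _ _ => Function.bijective_id

theorem BijBelow.comp {k : ℕ} {X Y Z : TreeObj} {f : X ⟶ Y} {g : Y ⟶ Z} (hf : BijBelow k f)
    (hg : BijBelow k g) : BijBelow k (f ≫ g) :=
  fun i hi => (hg i hi).comp (hf i hi)

theorem BijBelow.of_comp_right {k : ℕ} {X Y Z : TreeObj} {f : X ⟶ Y} {g : Y ⟶ Z}
    (hg : BijBelow k g) (hfg : BijBelow k (f ≫ g)) : BijBelow k f :=
  fun i hi => ((hg i hi).of_comp_iff' (f.app i)).1 (hfg i hi)

theorem bijBelow_of_isIso (k : ℕ) {X Y : TreeObj} (f : X ⟶ Y) [IsIso f] : BijBelow k f := by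
  intro i _
  refine Function.bijective_iff_has_inverse.2 ⟨(inv f).app i, fun x => ?_, fun y => ?_⟩
  · rw [← comp_app, IsIso.hom_inv_id, id_app]
  · rw [← comp_app, IsIso.inv_hom_id, id_app]

theorem isIso_of_bijective {X Y : TreeObj} (f : X ⟶ Y)
    (hf : ∀ i, Function.Bijective (f.app i)) : IsIso f := by
  let e : ∀ i, X.set i ≃ Y.set i := fun i => Equiv.ofBijective _ (hf i)
  let g : Y ⟶ X := Hom.mk (fun i => (e i).symm) fun i y => by
    obtain ⟨x, rfl⟩ := (e (i + 1)).surjective y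
    rw [Equiv.symm_apply_apply, Equiv.symm_apply_eq]
    exact (f.naturality i x).symm
  exact ⟨g, hom_ext fun i x => (e i).symm_apply_apply x,
    hom_ext fun i y => (e i).apply_symm_apply y⟩

theorem BijBelow.prodMap {k : ℕ} {X X' Y Y' : TreeObj} {f : X ⟶ X'} {g : Y ⟶ Y'}
    (hf : BijBelow k f) (hg : BijBelow k g) : BijBelow k (prodMap f g) :=
  fun i hi => (hf i hi).prodMap (hg i hi)

theorem BijBelow.sumMap {k : ℕ} {X X' Y Y' : TreeObj} {f : X ⟶ X'} {g : Y ⟶ Y'}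
    (hf : BijBelow k f) (hg : BijBelow k g) : BijBelow k (sumMap f g) :=
  fun i hi => ⟨Sum.map_injective.2 ⟨(hf i hi).1, (hg i hi).1⟩,
    Sum.map_surjective.2 ⟨(hf i hi).2, (hg i hi).2⟩⟩

/-- An exponential at stage `i` involves all stages up to `i`, which is why bijectivity is tracked
on initial segments. -/
theorem BijBelow.expMap {k : ℕ} {X X' Y Y' : TreeObj} {f : X' ⟶ X} {g : Y ⟶ Y'}
    (hf : BijBelow k f) (hg : BijBelow k g) : BijBelow k (expMap f g) := by
  intro i hi
  constructor
  · intro s t hst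
    refine ExpSet.ext (funext fun m => funext fun h => funext fun x => ?_)
    obtain ⟨x, rfl⟩ := (hf m (h.trans_lt hi)).2 x
    refine (hg m (h.trans_lt hi)).1 ?_
    exact congrArg (fun u : ExpSet X' Y' i => u.fn m h x) hst
  · intro t
    let e : ∀ m, m ≤ i → X'.set m ≃ X.set m :=
      fun m h => Equiv.ofBijective _ (hf m (h.trans_lt hi))
    let e' : ∀ m, m ≤ i → Y.set m ≃ Y'.set m :=
      fun m h => Equiv.ofBijective _ (hg m (h.trans_lt hi))
    refine ⟨⟨fun m h x => (e' m h).symm (t.fn m h ((e m h).symm x)), fun m h x => ?_⟩, ?_⟩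
    · obtain ⟨x, rfl⟩ := (e (m + 1) h).surjective x
      have hx : X.res m (e (m + 1) h x) = e m (Nat.le_of_succ_le h) (X'.res m x) :=
        (f.naturality m x).symm
      rw [hx, Equiv.symm_apply_apply, Equiv.symm_apply_apply, t.naturality m h,
        Equiv.symm_apply_eq]
      refine Eq.trans ?_ (g.naturality m _).symm
      exact congrArg (Y'.res m) ((e' (m + 1) h).apply_symm_apply _).symm
    · refine ExpSet.ext (funext fun m => funext fun h => funext fun x => ?_)
      refine ((e' m h).apply_symm_apply _).trans ?_
      exact congrArg (t.fn m h) ((e m h).symm_apply_apply x)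

theorem BijBelow.later {k : ℕ} {X Y : TreeObj} {f : X ⟶ Y} (hf : BijBelow k f) :
    BijBelow (k + 1) (later.map f)
  | 0, _ => Function.bijective_id
  | i + 1, hi => hf i (Nat.lt_of_succ_lt_succ hi)

/-- The part of `TotalInhabited` that concerns the stages below `k`. -/
structure TotalInhabitedBelow (k : ℕ) (X : TreeObj) : Prop where
  total : ∀ i, i + 1 < k → Function.Surjective (X.res i)
  inhabited : ∀ i, i < k → Nonempty (X.set i)

theorem TotalInhabitedBelow.mono {k l : ℕ} (h : k ≤ l) {X : TreeObj}
    (hX : X.TotalInhabitedBelow l) : X.TotalInhabitedBelow k :=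
  ⟨fun i hi => hX.total i (hi.trans_le h), fun i hi => hX.inhabited i (hi.trans_le h)⟩

theorem totalInhabited_of_forall_below {X : TreeObj} (h : ∀ k, X.TotalInhabitedBelow (k + 1)) :
    X.TotalInhabited :=
  ⟨fun i => (h (i + 1)).total i (Nat.lt_succ_self _),
    fun i => (h i).inhabited i (Nat.lt_succ_self _)⟩

theorem totalInhabitedBelow_zero (X : TreeObj) : X.TotalInhabitedBelow 0 :=
  ⟨fun _ h => absurd h (Nat.not_lt_zero _), fun _ h => absurd h (Nat.not_lt_zero _)⟩

theorem totalInhabitedBelow_const (k : ℕ) (Z : Type) [h : Nonempty Z] :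
    (const Z).TotalInhabitedBelow k :=
  ⟨fun _ _ z => ⟨z, rfl⟩, fun _ _ => h⟩

theorem TotalInhabitedBelow.of_iso {k : ℕ} {X Y : TreeObj} (hX : X.TotalInhabitedBelow k)
    (e : X ≅ Y) : Y.TotalInhabitedBelow k := by
  refine ⟨fun i hi y => ?_, fun i hi => (hX.inhabited i hi).map (e.hom.app i)⟩
  obtain ⟨x, hx⟩ := hX.total i hi (e.inv.app i y)
  refine ⟨e.hom.app (i + 1) x, ?_⟩
  rw [← e.hom.naturality, hx, ← comp_app, Iso.inv_hom_id, id_app]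

theorem TotalInhabitedBelow.prod {k : ℕ} {X Y : TreeObj} (hX : X.TotalInhabitedBelow k)
    (hY : Y.TotalInhabitedBelow k) : (X.prod Y).TotalInhabitedBelow k :=
  ⟨fun i hi => (hX.total i hi).prodMap (hY.total i hi),
    fun i hi => ⟨((hX.inhabited i hi).some, (hY.inhabited i hi).some)⟩⟩

theorem TotalInhabitedBelow.sum {k : ℕ} {X Y : TreeObj} (hX : X.TotalInhabitedBelow k)
    (hY : Y.TotalInhabitedBelow k) : (X.sum Y).TotalInhabitedBelow k :=
  ⟨fun i hi => Sum.map_surjective.2 ⟨hX.total i hi, hY.total i hi⟩,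
    fun i hi => (hX.inhabited i hi).map Sum.inl⟩

theorem TotalInhabitedBelow.later {k : ℕ} {X : TreeObj} (hX : X.TotalInhabitedBelow k) :
    (later.obj X).TotalInhabitedBelow (k + 1) := by
  constructor
  · rintro (_ | i) hi
    -- The map to the new singleton is onto only because `X` is inhabited at stage `0`.
    · exact fun _ => (hX.inhabited 0 (Nat.lt_of_succ_lt_succ hi)).elim fun x => ⟨x, rfl⟩
    · exact hX.total i (Nat.lt_of_succ_lt_succ hi)
  · rintro (_ | i) hi
    · exact ⟨PUnit.unit⟩
    · exact hX.inhabited i (Nat.lt_of_succ_lt_succ hi)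

/-- A tuple is prolonged by one function, obtained by choosing preimages in `Y` pointwise; `X` is
arbitrary. -/
theorem exp_res_surjective {X Y : TreeObj} {i : ℕ} (hY : Function.Surjective (Y.res i)) :
    Function.Surjective ((X.exp Y).res i) := by
  intro (t : ExpSet X Y i)
  choose u hu using fun x : X.set (i + 1) => hY (t.fn i le_rfl (X.res i x))
  let fn : ∀ m, m ≤ i + 1 → X.set m → Y.set m := fun m h =>
    if hm : m ≤ i then t.fn m hm
    else (show i + 1 = m by omega) ▸ u
  refine ⟨⟨fn, fun m h x => ?_⟩, ExpSet.ext (funext fun m => funext fun h => dif_pos h)⟩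
  by_cases hm : m + 1 ≤ i
  · simp only [fn, dif_pos hm, dif_pos (Nat.le_of_succ_le hm)]
    exact t.naturality m hm x
  · obtain rfl : m = i := by omega
    simp only [fn, dif_neg hm, dif_pos le_rfl]
    exact (hu x).symm

theorem TotalInhabitedBelow.exp {k : ℕ} (X : TreeObj) {Y : TreeObj}
    (hY : Y.TotalInhabitedBelow k) : (X.exp Y).TotalInhabitedBelow k := by
  have total : ∀ i, i + 1 < k → Function.Surjective ((X.exp Y).res i) :=
    fun i hi => exp_res_surjective (hY.total i hi)
  refine ⟨total, fun i => ?_⟩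
  induction i with
  | zero =>
    intro hi
    obtain ⟨y⟩ := hY.inhabited 0 hi
    refine ⟨⟨fun m h _ => (Nat.le_zero.1 h).symm ▸ y, fun m h => ?_⟩⟩
    exact absurd h (Nat.not_succ_le_zero m)
  | succ i ih =>
    intro hi
    obtain ⟨t⟩ := ih (Nat.lt_of_succ_lt hi)
    exact (total i hi t).nonempty

/-- Iterating chosen sections of the restrictions from a point at stage `0` gives a compatible
sequence. -/
theorem TotalInhabited.nonempty_globalElements {X : TreeObj} (hX : X.TotalInhabited) :
    Nonempty (const PUnit ⟶ X) := by
  choose g hg using hX.total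
  obtain ⟨x⟩ := hX.inhabited 0
  exact ⟨Hom.mk (fun i _ => Nat.rec x (fun i y => g i y) i) fun i _ => (hg i _).symm⟩

/-! ### Limits of towers -/

/-- The pointwise limit of a tower of functors into the topos of trees. -/
def towerLimit {C : Type*} [Category C] (T : ℕ → C ⥤ TreeObj) (t : ∀ k, T (k + 1) ⟶ T k) :
    C ⥤ TreeObj where
  obj W :=
    { set := fun i => {x : ∀ k, ((T k).obj W).set i // ∀ k, ((t k).app W).app i (x (k + 1)) = x k}
      res := fun i x => ⟨fun k => ((T k).obj W).res i (x.1 k), fun k => by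
        rw [((t k).app W).naturality, x.2]⟩ }
  map f := Hom.mk
    (fun i x => ⟨fun k => ((T k).map f).app i (x.1 k), fun k => by
      rw [← comp_app, (t k).naturality, comp_app, x.2]⟩)
    fun i x => Subtype.ext (funext fun k => ((T k).map f).naturality i (x.1 k))
  map_id W := hom_ext fun i x => Subtype.ext (funext fun k => by
    change ((T k).map (𝟙 W)).app i (x.1 k) = x.1 k
    rw [(T k).map_id]; rfl)
  map_comp f g := hom_ext fun i x => Subtype.ext (funext fun k => by
    change ((T k).map (f ≫ g)).app i (x.1 k) = ((T k).map g).app i (((T k).map f).app i (x.1 k))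
    rw [(T k).map_comp]; rfl)

section towerLimit

variable {C : Type*} [Category C] {T : ℕ → C ⥤ TreeObj} {t : ∀ k, T (k + 1) ⟶ T k}

/-- The projections of the limit of a tower. -/
def towerLimit.proj (T : ℕ → C ⥤ TreeObj) (t : ∀ k, T (k + 1) ⟶ T k) (k : ℕ) :
    towerLimit T t ⟶ T k where
  app _ := Hom.mk (fun _ x => x.1 k) fun _ _ => rfl
  naturality _ _ _ := rfl

theorem towerLimit.proj_comp (k : ℕ) : proj T t (k + 1) ≫ t k = proj T t k :=
  NatTrans.ext (funext fun _ => hom_ext fun _ x => x.2 k)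

/-- The map into the limit of a tower given by a cone. -/
def towerLimit.lift {H : C ⥤ TreeObj} (c : ∀ k, H ⟶ T k) (hc : ∀ k, c (k + 1) ≫ t k = c k) :
    H ⟶ towerLimit T t where
  app W := Hom.mk
    (fun i x => ⟨fun k => ((c k).app W).app i x, fun k =>
      congrArg (fun u : H ⟶ T k => (u.app W).app i x) (hc k)⟩)
    fun i x => Subtype.ext (funext fun k => ((c k).app W).naturality i x)
  naturality W V f := hom_ext fun i x => Subtype.ext (funext fun k => by
    change (H.map f ≫ (c k).app V).app i x = ((c k).app W ≫ (T k).map f).app i x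
    rw [(c k).naturality])

theorem towerLimit.hom_ext {H : C ⥤ TreeObj} {f g : H ⟶ towerLimit T t}
    (h : ∀ k, f ≫ proj T t k = g ≫ proj T t k) : f = g :=
  NatTrans.ext (funext fun W => TreeObj.hom_ext fun i x => Subtype.ext (funext fun k =>
    congrArg (fun u : H ⟶ T k => (u.app W).app i x) (h k)))

/-- If the maps of a tower from `T k` on are injective at a stage, then so is the projection to
`T k`. -/
theorem towerLimit.proj_injective (W : C) {i k : ℕ}
    (h : ∀ m, k ≤ m → Function.Injective (((t m).app W).app i)) :
    Function.Injective (((proj T t k).app W).app i) := by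
  intro x y (hxy : x.1 k = y.1 k)
  refine Subtype.ext (funext fun m => ?_)
  -- Above `k`, injectivity lifts the equality; below `k`, coordinates are images of the `k`-th one.
  rcases le_total k m with hm | hm
  · induction m, hm using Nat.le_induction with
    | base => exact hxy
    | succ m hm ih =>
      refine h m hm ?_
      rw [x.2, y.2, ih]
  · induction hm using Nat.decreasingInduction with
    | self => exact hxy
    | of_succ m hm ih => rw [← x.2, ← y.2, ih]

end towerLimit

end TreeObj

namespace Env

open TreeObj

variable {n : ℕ}

/-! ### Local functors -/

/-- Both components of an arrow of `𝓢ᵒᵖ × 𝓢` are bijective at stages below `k`. -/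
def PairBijBelow (k : ℕ) {p q : TreeObjᵒᵖ × TreeObj} (f : p ⟶ q) : Prop :=
  BijBelow k f.1.unop ∧ BijBelow k f.2

theorem PairBijBelow.mono {k l : ℕ} (h : k ≤ l) {p q : TreeObjᵒᵖ × TreeObj} {f : p ⟶ q}
    (hf : PairBijBelow l f) : PairBijBelow k f :=
  ⟨hf.1.mono h, hf.2.mono h⟩

/-- What `F` does at stages `≤ k` depends only on the stages `≤ k` of its arguments, and only on
the stages `< k` of the arguments in `S`, in the sense that arrows that are bijective at these
stages are sent to arrows that are bijective at stages `≤ k`. -/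
def LocalOn (S : Fin n → Prop) (F : Env n ⥤ TreeObj) : Prop :=
  ∀ ⦃k : ℕ⦄ ⦃W V : Env n⦄ (f : W ⟶ V), (∀ i, PairBijBelow k (f i)) →
    (∀ i, ¬ S i → PairBijBelow (k + 1) (f i)) → BijBelow (k + 1) (F.map f)

theorem LocalOn.bijBelow {S : Fin n → Prop} {F : Env n ⥤ TreeObj} (hF : LocalOn S F) {k : ℕ}
    {W V : Env n} (f : W ⟶ V) (hf : ∀ i, PairBijBelow k (f i)) : BijBelow k (F.map f) := by
  cases k with
  | zero => exact bijBelow_zero _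
  | succ k => exact hF f (fun i => (hf i).mono k.le_succ) fun i _ => hf i

theorem LocalOn.mono {S T : Fin n → Prop} {F : Env n ⥤ TreeObj} (hF : LocalOn S F)
    (h : ∀ i, T i → S i) : LocalOn T F :=
  fun _ _ _ f hf hf' => hF f hf fun i hi => hf' i fun hT => hi (h i hT)

theorem localOn_const (S : Fin n → Prop) (X : TreeObj) :
    LocalOn S ((Functor.const (Env n)).obj X) :=
  fun k _ _ _ _ _ => bijBelow_id (k + 1) X

theorem localOn_varF (i : Fin n) : LocalOn (fun j => i ≠ j) (varF i) :=
  fun _ _ _ _ _ hf' => (hf' i (not_not.2 rfl)).2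

theorem LocalOn.prodF {S : Fin n → Prop} {F G : Env n ⥤ TreeObj} (hF : LocalOn S F)
    (hG : LocalOn S G) : LocalOn S (prodF F G) :=
  fun _ _ _ f hf hf' => (hF f hf hf').prodMap (hG f hf hf')

theorem LocalOn.sumF {S : Fin n → Prop} {F G : Env n ⥤ TreeObj} (hF : LocalOn S F)
    (hG : LocalOn S G) : LocalOn S (sumF F G) :=
  fun _ _ _ f hf hf' => (hF f hf hf').sumMap (hG f hf hf')

theorem LocalOn.expF {S : Fin n → Prop} {F G : Env n ⥤ TreeObj} (hF : LocalOn S F)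
    (hG : LocalOn S G) : LocalOn S (expF F G) :=
  fun _ _ _ f hf hf' =>
    (hF (swap.map f.op) (fun i => (hf i).symm) fun i hi => (hf' i hi).symm).expMap (hG f hf hf')

/-- `T` is arbitrary because the shift by `▷` makes every variable guarded. -/
theorem LocalOn.later {S : Fin n → Prop} {F : Env n ⥤ TreeObj} (hF : LocalOn S F)
    (T : Fin n → Prop) : LocalOn T (F ⋙ TreeObj.later) :=
  fun _ _ _ f hf _ => (hF.bijBelow f hf).later

/-- Up to isomorphisms, `G.map f` is `F` applied to `G.map f` and its swapped version in slot `0`.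
As that slot is guarded, only earlier stages of these are needed, so induction on the stage applies.
-/
theorem LocalOn.of_extend_iso {S : Fin (n + 1) → Prop} {F : Env (n + 1) ⥤ TreeObj}
    (hF : LocalOn S F) (h0 : S 0) {G : Env n ⥤ TreeObj} (e : extend G ⋙ F ≅ G) :
    LocalOn (fun i => S i.succ) G := by
  intro k
  induction k with
  | zero =>
    intro W V f hf hf'
    rw [← NatIso.naturality_1 e f]
    refine (bijBelow_of_isIso _ _).comp (BijBelow.comp ?_ (bijBelow_of_isIso _ _))
    refine hF ((extend G).map f) (fun i => ⟨bijBelow_zero _, bijBelow_zero _⟩) fun i => ?_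
    exact Fin.cases (fun h => absurd h0 h) (fun j hj => hf' j hj) i
  | succ k ih =>
    intro W V f hf hf'
    rw [← NatIso.naturality_1 e f]
    refine (bijBelow_of_isIso _ _).comp (BijBelow.comp ?_ (bijBelow_of_isIso _ _))
    refine hF ((extend G).map f) (fun i => ?_) fun i => ?_
    · refine Fin.cases ⟨?_, ?_⟩ (fun j => hf j) i
      · exact ih (swap.map f.op) (fun i => ((hf i).mono k.le_succ).symm) fun i _ => (hf i).symm
      · exact ih f (fun i => (hf i).mono k.le_succ) fun i _ => hf i
    · exact Fin.cases (fun h => absurd h0 h) (fun j hj => hf' j hj) i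

/-! ### Existence of fixed points -/

/-- The functor `W ↦ (W, N W', P W)`. -/
def extendPair (N P : Env n ⥤ TreeObj) : Env n ⥤ Env (n + 1) where
  obj W := Fin.cases (op (N.obj (swap.obj (op W))), P.obj W) W
  map {_ _} f := Fin.cases ((N.map (swap.map f.op)).op, P.map f) f
  map_id W := by
    funext i
    refine Fin.cases ?_ (fun j => rfl) i
    refine Prod.ext ?_ (P.map_id W)
    exact congrArg Quiver.Hom.op (N.map_id (swap.obj (op W)))
  map_comp f g := by
    funext i
    refine Fin.cases ?_ (fun j => rfl) i
    refine Prod.ext ?_ (P.map_comp f g)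
    exact congrArg Quiver.Hom.op (N.map_comp (swap.map g.op) (swap.map f.op))

/-- Action of `extendPair` on natural transformations, contravariant in the first argument. -/
def extendPairMap {N N' P P' : Env n ⥤ TreeObj} (ν : N' ⟶ N) (ρ : P ⟶ P') :
    extendPair N P ⟶ extendPair N' P' where
  app W := Fin.cases ((ν.app (swap.obj (op W))).op, ρ.app W) fun j => 𝟙 (W j)
  naturality W V f := by
    funext i
    refine Fin.cases ?_ (fun j => ?_) i
    · refine Prod.ext ?_ (ρ.naturality f)
      exact congrArg Quiver.Hom.op (ν.naturality (swap.map f.op)).symm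
    · exact (Category.comp_id (f j)).trans (Category.id_comp (f j)).symm

theorem extendPairMap_comp {N N' N'' P P' P'' : Env n ⥤ TreeObj} (ν : N' ⟶ N) (ρ : P ⟶ P')
    (ν' : N'' ⟶ N') (ρ' : P' ⟶ P'') :
    extendPairMap ν ρ ≫ extendPairMap ν' ρ' = extendPairMap (ν' ≫ ν) (ρ ≫ ρ') := by
  refine NatTrans.ext (funext fun W => funext fun i => ?_)
  exact Fin.cases rfl (fun j => Category.comp_id (𝟙 (W j))) i

/-- The unique natural transformation from the initial functor. -/
def fromEmpty (H : Env n ⥤ TreeObj) : constF Empty ⟶ H where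
  app _ := Hom.mk (fun _ x => Empty.elim x) fun _ x => Empty.elim x
  naturality _ _ _ := TreeObj.hom_ext fun _ x => Empty.elim x

/-- The unique natural transformation to the terminal functor. -/
def toPUnit (H : Env n ⥤ TreeObj) : H ⟶ constF PUnit where
  app _ := Hom.mk (fun _ _ => PUnit.unit) fun _ _ => rfl
  naturality _ _ _ := rfl

theorem fromEmpty_ext {H : Env n ⥤ TreeObj} (f g : constF Empty ⟶ H) : f = g :=
  NatTrans.ext (funext fun _ => TreeObj.hom_ext fun _ x => Empty.elim x)

theorem toPUnit_ext {H : Env n ⥤ TreeObj} (f g : H ⟶ constF PUnit) : f = g :=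
  NatTrans.ext (funext fun _ => TreeObj.hom_ext fun _ _ => rfl)

section Approximation

variable (F : Env (n + 1) ⥤ TreeObj)

/-- Action of `(N, P) ↦ F (W, N W', P W)` on natural transformations. -/
def pairMap {N N' P P' : Env n ⥤ TreeObj} (ν : N' ⟶ N) (ρ : P ⟶ P') :
    extendPair N P ⋙ F ⟶ extendPair N' P' ⋙ F :=
  Functor.whiskerRight (extendPairMap ν ρ) F

theorem pairMap_comp {N N' N'' P P' P'' : Env n ⥤ TreeObj} (ν : N' ⟶ N) (ρ : P ⟶ P')
    (ν' : N'' ⟶ N') (ρ' : P' ⟶ P'') :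
    pairMap F ν ρ ≫ pairMap F ν' ρ' = pairMap F (ν' ≫ ν) (ρ ≫ ρ') := by
  rw [pairMap, pairMap, pairMap, ← extendPairMap_comp, Functor.whiskerRight_comp]

theorem bijBelow_pairMap {F : Env (n + 1) ⥤ TreeObj} {S : Fin (n + 1) → Prop}
    (hF : LocalOn S F) (h0 : S 0)
    {N N' P P' : Env n ⥤ TreeObj} {ν : N' ⟶ N} {ρ : P ⟶ P'} {k : ℕ}
    (hν : ∀ W, BijBelow k (ν.app W)) (hρ : ∀ W, BijBelow k (ρ.app W)) (W : Env n) :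
    BijBelow (k + 1) ((pairMap F ν ρ).app W) := by
  refine hF ((extendPairMap ν ρ).app W) (fun i => ?_) fun i => ?_
  · exact Fin.cases ⟨hν _, hρ _⟩ (fun j => ⟨bijBelow_id _ _, bijBelow_id _ _⟩) i
  · exact Fin.cases (fun h => absurd h0 h) (fun j _ => ⟨bijBelow_id _ _, bijBelow_id _ _⟩) i

/-- The approximations of the fixed point of `F`, from below (first component, starting with the
initial functor) and from above (second component, starting with the terminal functor). -/
def approx : ℕ → (Env n ⥤ TreeObj) × (Env n ⥤ TreeObj)
  | 0 => (constF Empty, constF PUnit)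
  -- The contravariant slot takes the approximation from the opposite side.
  | k + 1 => (extendPair (approx k).2 (approx k).1 ⋙ F, extendPair (approx k).1 (approx k).2 ⋙ F)

/-- The maps between successive approximations. -/
def approxStep : ∀ k, ((approx F k).1 ⟶ (approx F (k + 1)).1) ×
    ((approx F (k + 1)).2 ⟶ (approx F k).2)
  | 0 => (fromEmpty _, toPUnit _)
  | k + 1 => (pairMap F (approxStep k).2 (approxStep k).1,
      pairMap F (approxStep k).1 (approxStep k).2)

/-- The comparison of approximations from below with approximations from above. -/
def approxCompare : ∀ k j, (approx F k).1 ⟶ (approx F j).2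
  | 0, _ => fromEmpty _
  | _ + 1, 0 => toPUnit _
  -- Contravariance exchanges the two indices, so neither decreases on its own, but their sum does.
  | k + 1, j + 1 => pairMap F (approxCompare j k) (approxCompare k j)
termination_by k j => k + j

/-- The two halves are proved together: each inductive step needs one in the negative slot and the
other in the positive slot. -/
theorem approxCompare_comp_step (k j : ℕ) :
    approxCompare F k (j + 1) ≫ (approxStep F j).2 = approxCompare F k j ∧
      (approxStep F j).1 ≫ approxCompare F (j + 1) k = approxCompare F j k := by
  induction k generalizing j with
  | zero => exact ⟨fromEmpty_ext _ _, toPUnit_ext _ _⟩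
  | succ k ih =>
    cases j with
    | zero => exact ⟨toPUnit_ext _ _, fromEmpty_ext _ _⟩
    | succ j =>
      obtain ⟨h₁, h₂⟩ := ih j
      constructor
      · rw [approxCompare, approxCompare, approxStep]
        exact (pairMap_comp F _ _ _ _).trans (by rw [h₁, h₂])
      · rw [approxCompare, approxCompare, approxStep]
        exact (pairMap_comp F _ _ _ _).trans (by rw [h₁, h₂])

variable {F} {S : Fin (n + 1) → Prop}

theorem bijBelow_approxStep (hF : LocalOn S F) (h0 : S 0) (k : ℕ) :
    (∀ W, BijBelow k ((approxStep F k).1.app W)) ∧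
      ∀ W, BijBelow k ((approxStep F k).2.app W) := by
  induction k with
  | zero => exact ⟨fun _ => bijBelow_zero _, fun _ => bijBelow_zero _⟩
  | succ k ih =>
    exact ⟨bijBelow_pairMap hF h0 ih.2 ih.1, bijBelow_pairMap hF h0 ih.1 ih.2⟩

theorem bijBelow_approxCompare (hF : LocalOn S F) (h0 : S 0) (k : ℕ) (W : Env n) :
    BijBelow k ((approxCompare F k k).app W) := by
  induction k generalizing W with
  | zero => exact bijBelow_zero _
  | succ k ih =>
    rw [approxCompare]
    exact bijBelow_pairMap hF h0 ih ih W

/-- The limit of the approximations from above. -/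
def approxLimit (F : Env (n + 1) ⥤ TreeObj) : Env n ⥤ TreeObj :=
  towerLimit (fun k => (approx F k).2) fun k => (approxStep F k).2

/-- The projections from the limit to the approximations from above. -/
def approxProj (F : Env (n + 1) ⥤ TreeObj) (k : ℕ) : approxLimit F ⟶ (approx F k).2 :=
  towerLimit.proj _ _ k

/-- The maps from the approximations from below to the limit. -/
def approxIncl (F : Env (n + 1) ⥤ TreeObj) (k : ℕ) : (approx F k).1 ⟶ approxLimit F :=
  towerLimit.lift (approxCompare F k) fun j => (approxCompare_comp_step F k j).1

theorem approxStep_incl (k : ℕ) : (approxStep F k).1 ≫ approxIncl F (k + 1) = approxIncl F k :=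
  towerLimit.hom_ext fun j => (approxCompare_comp_step F j k).2

theorem approxProj_step (k : ℕ) : approxProj F (k + 1) ≫ (approxStep F k).2 = approxProj F k :=
  towerLimit.proj_comp k

/-- Injectivity holds because the tower is stationary at stages below `k` from index `k` on.
Surjectivity holds because the bijective comparison `approxCompare F k k` factors through the
projection. -/
theorem bijBelow_approxProj (hF : LocalOn S F) (h0 : S 0) (k : ℕ) (W : Env n) :
    BijBelow k ((approxProj F k).app W) := by
  refine fun i hi => ⟨?_, ?_⟩
  · exact towerLimit.proj_injective W fun m hm =>
      ((bijBelow_approxStep hF h0 m).2 W i (hi.trans_le hm)).1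
  · refine Function.Surjective.of_comp (g := ((approxIncl F k).app W).app i) ?_
    exact (bijBelow_approxCompare hF h0 k W i hi).2

theorem bijBelow_approxIncl (hF : LocalOn S F) (h0 : S 0) (k : ℕ) (W : Env n) :
    BijBelow k ((approxIncl F k).app W) :=
  (bijBelow_approxProj hF h0 k W).of_comp_right (bijBelow_approxCompare hF h0 k W)

/-- The cone over the approximations from above with vertex `W ↦ F (W, G W', G W)`, where `G` is
their limit. -/
def approxCone (F : Env (n + 1) ⥤ TreeObj) : ∀ k, extend (approxLimit F) ⋙ F ⟶ (approx F k).2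
  | 0 => toPUnit _
  -- Here `extend G` is `extendPair G G` by definition.
  | k + 1 => pairMap F (approxIncl F k) (approxProj F k)

theorem approxCone_step (k : ℕ) :
    approxCone F (k + 1) ≫ (approxStep F k).2 = approxCone F k := by
  cases k with
  | zero => exact toPUnit_ext _ _
  | succ k =>
    refine (pairMap_comp F _ _ _ _).trans ?_
    rw [approxStep_incl, approxProj_step]
    rfl

theorem exists_extend_iso (hF : LocalOn S F) (h0 : S 0) :
    ∃ G : Env n ⥤ TreeObj, Nonempty (extend G ⋙ F ≅ G) := by
  let θ : extend (approxLimit F) ⋙ F ⟶ approxLimit F :=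
    towerLimit.lift (approxCone F) approxCone_step
  have hθ : ∀ W, IsIso (θ.app W) := fun W => isIso_of_bijective _ fun i =>
    -- `θ` followed by the projection to index `i + 1` is `approxCone F (i + 1)`; both this and the
    -- projection are bijective at stage `i`.
    (bijBelow_approxProj hF h0 (i + 1) W).of_comp_right (f := θ.app W)
      (bijBelow_pairMap hF h0 (bijBelow_approxIncl hF h0 i) (bijBelow_approxProj hF h0 i) W)
      i i.lt_succ_self
  have : IsIso θ := NatIso.isIso_of_isIso_app θ
  exact ⟨approxLimit F, ⟨asIso θ⟩⟩

/-- This excludes the default branch of `fix`; uniqueness of the fixed point is never needed. -/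
theorem nonempty_extend_fix_iso (hF : LocalOn S F) (h0 : S 0) :
    Nonempty (extend (fix F) ⋙ F ≅ fix F) := by
  have h := exists_extend_iso hF h0
  rw [fix, dif_pos h]
  exact h.choose_spec

end Approximation

end Env

/-! ### Induction on types -/

namespace Ty

open TreeObj Env

theorem localOn_denF {n : ℕ} (A : Ty n) (hA : A.WellFormed) : LocalOn A.Guarded A.denF := by
  induction A with
  | var i => exact localOn_varF i
  | nat => exact localOn_const _ _
  | one => exact localOn_const _ _
  | prod A B ihA ihB =>
    exact ((ihA hA.1).mono fun i h => h.1).prodF ((ihB hA.2).mono fun i h => h.2)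
  | zero => exact localOn_const _ _
  | sum A B ihA ihB =>
    exact ((ihA hA.1).mono fun i h => h.1).sumF ((ihB hA.2).mono fun i h => h.2)
  | arrow A B ihA ihB =>
    exact ((ihA hA.1).mono fun i h => h.1).expF ((ihB hA.2).mono fun i h => h.2)
  | mu A ih =>
    obtain ⟨e⟩ := nonempty_extend_fix_iso (ih hA.2) hA.1
    exact (ih hA.2).of_extend_iso hA.1 e
  | later A ih => exact (ih hA).later _
  | box A _ => exact localOn_const _ _

/-- The denotation of `A` is total and inhabited at stages `≤ k` if all positive arguments are so
at stages `< k`, and those for unguarded variables at stages `≤ k`. -/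
theorem totalInhabitedBelow_denF {n : ℕ} (A : Ty n) (hA : A.WellFormed) (h0 : ¬ A.HasZero)
    (k : ℕ) (W : Env n) (hW : ∀ i, (W i).2.TotalInhabitedBelow k)
    (hW' : ∀ i, ¬ A.Guarded i → (W i).2.TotalInhabitedBelow (k + 1)) :
    (A.denF.obj W).TotalInhabitedBelow (k + 1) := by
  induction A generalizing k with
  | var i => exact hW' i (not_not.2 rfl)
  | nat => exact totalInhabitedBelow_const _ ℕ
  | one => exact totalInhabitedBelow_const _ PUnit
  | prod A B ihA ihB =>
    exact (ihA hA.1 (fun h => h0 (.inl h)) k W hW fun i hi => hW' i fun h => hi h.1).prod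
      (ihB hA.2 (fun h => h0 (.inr h)) k W hW fun i hi => hW' i fun h => hi h.2)
  | zero => exact absurd trivial h0
  | sum A B ihA ihB =>
    exact (ihA hA.1 (fun h => h0 (.inl h)) k W hW fun i hi => hW' i fun h => hi h.1).sum
      (ihB hA.2 (fun h => h0 (.inr h)) k W hW fun i hi => hW' i fun h => hi h.2)
  | arrow A B _ ihB =>
    exact (ihB hA.2 (fun h => h0 (.inr h)) k W hW fun i hi => hW' i fun h => hi h.2).exp _
  | mu A ih =>
    obtain ⟨e⟩ := nonempty_extend_fix_iso (localOn_denF A hA.2) hA.1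
    have step : ∀ k, (∀ i, (W i).2.TotalInhabitedBelow k) →
        (∀ i : Fin _, ¬ A.Guarded i.succ → (W i).2.TotalInhabitedBelow (k + 1)) →
        ((Env.fix A.denF).obj W).TotalInhabitedBelow k →
        ((Env.fix A.denF).obj W).TotalInhabitedBelow (k + 1) := fun k hW hW' h =>
      (ih hA.2 h0 k ((extend (Env.fix A.denF)).obj W) (Fin.cases h hW)
        (Fin.cases (fun h => absurd hA.1 h) hW')).of_iso (e.app W)
    -- It remains to treat the fixed point below `k`, by induction on stages. There `hW` already
    -- covers the unguarded variables, so `hW'` can be dropped.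
    refine step k hW hW' ?_
    clear hW'
    induction k with
    | zero => exact totalInhabitedBelow_zero _
    | succ k ihk =>
      have hk : ∀ i, (W i).2.TotalInhabitedBelow k := fun i => (hW i).mono k.le_succ
      exact step k hk (fun i _ => hW i) (ihk hk)
  | later A ih =>
    cases k with
    | zero => exact (totalInhabitedBelow_zero _).later
    | succ k => exact (ih hA h0 k W (fun i => (hW i).mono k.le_succ) fun i _ => hW i).later
  | box A ih =>
    -- A closed body has no arguments to bound, so the induction hypothesis holds at every stage, as
    -- global elements require.
    have h : (A.denF.obj Fin.elim0).TotalInhabited := totalInhabited_of_forall_below fun k =>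
      ih hA h0 k Fin.elim0 (fun j => j.elim0) fun j => j.elim0
    have := h.nonempty_globalElements
    exact totalInhabitedBelow_const _ _

end Ty

theorem corollary3p7 (A : Ty 0) (hA : A.WellFormed) (h0 : ¬ A.HasZero) :
    A.den.TotalInhabited :=
  TreeObj.totalInhabited_of_forall_below fun k =>
    A.totalInhabitedBelow_denF hA h0 k Fin.elim0 (fun j => j.elim0) fun j => j.elim0
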